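/- Let $\Omega=(0,1)$ and $T>0$. Let $\mathrm{trace}:H^1(\Omega)\to L^2(\partial\Omega)=\mathbb{R}^2$ be the trace operator, i.e. the bounded linear operator with $\mathrm{trace}(v)=(f(0),f(1))$ whenever $v\in H^1(\Omega)$ is given by a function $f$ that is continuous on $[0,1]$; write $\mathrm{trace}(v)(0)$ and $\mathrm{trace}(v)(1)$ for its two components. Then there is a constant $C>0$, depending only on $T$ and $\Omega$, with the following property. Let $\mathbf u\in L^2(0,T;H^2(\Omega))$ have a weak time derivative $\mathbf u'\in L^2(0,T;L^2(\Omega))$, i.e. $$\int_0^T\varphi'(t)\,\mathbf u(t)\,dt=-\int_0^T\varphi(t)\,\mathbf u'(t)\,dt\quad\text{in }L^2(\Omega)\qquad\text{for all }\varphi\in C_c^\infty((0,T)).$$ Then $\mathbf u$ has, after modification on a null set of times, a continuous representative $[0,T]\to L^2(\Omega)$, so that the initial value $g:=\mathbf u(0)\in L^2(\Omega)$ (the value of this representative at $t=0$) is well defined; and, with $h_1(t):=\mathrm{trace}(\mathbf u(t))(0)$ and $h_2(t):=\mathrm{trace}(\mathbf u(t))(1)$ for a.e. $t\in(0,T)$,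 $$\|h_1\|_{L^2(0,T)}+\|h_2\|_{L^2(0,T)}+\|g\|_{L^2(\Omega)}\le C\left(\|\mathbf u\|_{L^2(0,T;H^2(\Omega))}+\|\mathbf u'\|_{L^2(0,T;L^2(\Omega))}\right).$$ -/

import Mathlib

open MeasureTheory Set Filter
open scoped ContDiff

namespace TraceEstimate

/-- The (Lebesgue-)Bochner space `L²((a,b); E)`. -/
abbrev L2 (a b : ℝ) (E : Type*) [NormedAddCommGroup E] : Type _ :=
  Lp E 2 (volume.restrict (Ioo a b))

/-- `φ ∈ C_c^∞((a,b))`. -/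
def IsTest (a b : ℝ) (φ : ℝ → ℝ) : Prop :=
  ContDiff ℝ ∞ φ ∧ HasCompactSupport φ ∧ tsupport φ ⊆ Ioo a b

/-- `f'` is the weak derivative of `f` on `(a,b)` (both with values in `E`):
`∫ φ' f = - ∫ φ f'` for every test function `φ`.  Only applied to functions of class `L²`. -/
def HasWeakDeriv {E : Type*} [NormedAddCommGroup E] [NormedSpace ℝ E]
    (a b : ℝ) (f f' : ℝ → E) : Prop :=
  ∀ φ : ℝ → ℝ, IsTest a b φ →
    ∫ x in Ioo a b, deriv φ x • f x = - ∫ x in Ioo a b, φ x • f' x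

section aux

variable {E : Type*} [NormedAddCommGroup E] [NormedSpace ℝ E]

theorem integrable_smul_L2 {a b : ℝ} {φ : ℝ → ℝ} (hφ : Continuous φ) (hc : HasCompactSupport φ)
    (f : L2 a b E) : Integrable (fun x => φ x • f x) (volume.restrict (Ioo a b)) := by
  obtain ⟨C, hC⟩ := hc.exists_bound_of_continuous hφ
  exact ((Lp.memLp f).integrable (by norm_num)).bdd_smul C hφ.aestronglyMeasurable
    (Eventually.of_forall hC)

theorem IsTest.deriv_continuous {a b : ℝ} {φ : ℝ → ℝ} (h : IsTest a b φ) :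
    Continuous (deriv φ) := h.1.continuous_deriv (by simp)

theorem HasWeakDeriv.congr {a b : ℝ} {f f' g g' : ℝ → E} (h : HasWeakDeriv a b f f')
    (hf : f =ᵐ[volume.restrict (Ioo a b)] g) (hf' : f' =ᵐ[volume.restrict (Ioo a b)] g') :
    HasWeakDeriv a b g g' := by
  intro φ hφ
  have h1 : ∫ x in Ioo a b, deriv φ x • f x = ∫ x in Ioo a b, deriv φ x • g x :=
    integral_congr_ae (hf.mono fun x hx => by simp only [hx])
  have h2 : ∫ x in Ioo a b, φ x • f' x = ∫ x in Ioo a b, φ x • g' x :=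
    integral_congr_ae (hf'.mono fun x hx => by simp only [hx])
  rw [← h1, ← h2]
  exact h φ hφ

end aux

/-- The Sobolev space `H^k(0,1)`, an element being recorded as the tuple `(v, v', …, v^(k))` of
its weak derivatives in `L²(0,1)`.  The norm is the usual one,
`‖v‖² = ‖v‖²_{L²} + ‖v'‖²_{L²} + … + ‖v^(k)‖²_{L²}`. -/
def Sob (k : ℕ) : Submodule ℝ (PiLp 2 (fun _ : Fin (k + 1) => L2 0 1 ℝ)) where
  carrier := {v | ∀ i : Fin k, HasWeakDeriv 0 1 (v i.castSucc) (v i.succ)}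
  zero_mem' := by
    intro i
    have h0 : HasWeakDeriv 0 1 (fun _ : ℝ => (0 : ℝ)) (fun _ => (0 : ℝ)) := by
      intro φ _; simp
    exact h0.congr (Lp.coeFn_zero ℝ 2 _).symm (Lp.coeFn_zero ℝ 2 _).symm
  add_mem' := by
    intro v w hv hw i
    have h0 : HasWeakDeriv 0 1 (fun x => v i.castSucc x + w i.castSucc x)
        (fun x => v i.succ x + w i.succ x) := by
      intro φ hφ
      simp only [smul_add]
      rw [integral_add (integrable_smul_L2 hφ.deriv_continuous hφ.2.1.deriv _)
          (integrable_smul_L2 hφ.deriv_continuous hφ.2.1.deriv _),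
        integral_add (integrable_smul_L2 hφ.1.continuous hφ.2.1 _)
          (integrable_smul_L2 hφ.1.continuous hφ.2.1 _), hv i φ hφ, hw i φ hφ]
      ring
    exact h0.congr (Lp.coeFn_add _ _).symm (Lp.coeFn_add _ _).symm
  smul_mem' := by
    intro c v hv i
    have h0 : HasWeakDeriv 0 1 (fun x => c • v i.castSucc x) (fun x => c • v i.succ x) := by
      intro φ hφ
      simp only [smul_comm _ c]
      rw [integral_smul, integral_smul, hv i φ hφ, smul_neg]
    exact h0.congr (Lp.coeFn_smul c (v i.castSucc)).symm (Lp.coeFn_smul c (v i.succ)).symm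

namespace Sob

/-- The inclusion `H^k(0,1) ⊆ L²(0,1)`. -/
noncomputable def toL2 (k : ℕ) : Sob k →L[ℝ] L2 0 1 ℝ :=
  (PiLp.proj 2 (𝕜 := ℝ) (fun _ : Fin (k + 1) => L2 0 1 ℝ) 0) ∘L (Sob k).subtypeL

/-- The inclusion `H^{k+1}(0,1) ⊆ H^k(0,1)`, forgetting the highest derivative. -/
noncomputable def incl (k : ℕ) : Sob (k + 1) →L[ℝ] Sob k :=
  LinearMap.mkContinuous
    { toFun := fun v => ⟨WithLp.toLp 2 (fun i => v.1 i.castSucc), fun i => v.2 i.castSucc⟩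
      map_add' := fun _ _ => rfl
      map_smul' := fun _ _ => rfl } 1 (by
    intro v
    rw [one_mul]
    change ‖WithLp.toLp 2 (fun i : Fin (k + 1) => v.1 i.castSucc)‖ ≤ ‖v.1‖
    rw [PiLp.norm_eq_of_L2, PiLp.norm_eq_of_L2]
    refine Real.sqrt_le_sqrt ?_
    rw [Fin.sum_univ_castSucc (n := k + 1)]
    exact le_add_of_nonneg_right (sq_nonneg _))

/-- An element of `H^k(0,1)` is determined by the underlying `L²` function. -/
theorem toL2_injective (k : ℕ) : Function.Injective (toL2 k) := by
  intro v w hvw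
  have main : ∀ i : Fin (k + 1), v.1 i = w.1 i := by
    intro i
    induction i using Fin.induction with
    | zero => exact hvw
    | succ i ih =>
      apply Lp.ext
      have hI : ∀ f : L2 0 1 ℝ, Integrable f (volume.restrict (Ioo 0 1)) := fun f =>
        (Lp.memLp f).integrable (by norm_num)
      have key := isOpen_Ioo.ae_eq_zero_of_integral_contDiff_smul_eq_zero
        (μ := volume.restrict (Ioo (0:ℝ) 1)) (U := Ioo 0 1)
        (f := fun x => v.1 i.succ x - w.1 i.succ x)
        ((((hI _).sub (hI _)).locallyIntegrable).locallyIntegrableOn _) (by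
          intro φ h1 h2 h3
          have hv := v.2 i φ ⟨h1, h2, h3⟩
          have hw := w.2 i φ ⟨h1, h2, h3⟩
          rw [ih] at hv
          simp only [smul_sub]
          rw [integral_sub (integrable_smul_L2 h1.continuous h2 _)
            (integrable_smul_L2 h1.continuous h2 _)]
          linarith)
      filter_upwards [key, ae_restrict_mem measurableSet_Ioo] with x hx hm
      linarith [hx hm]
  exact Subtype.ext (PiLp.ext main)

theorem toL2_incl (k : ℕ) (v : Sob (k + 1)) : toL2 k (incl k v) = toL2 (k + 1) v := rfl

end Sob

/-- `S : H¹(0,1) → L²({0,1}) = ℝ²` is a trace operator: it is bounded and linear, and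
`S v = (f 0, f 1)` whenever `v` is given by a function `f` that is continuous on `[0,1]`. -/
def IsTrace (S : Sob 1 →L[ℝ] EuclideanSpace ℝ (Fin 2)) : Prop :=
  ∀ (v : Sob 1) (f : ℝ → ℝ), ContinuousOn f (Icc 0 1) →
    Sob.toL2 1 v =ᵐ[volume.restrict (Ioo 0 1)] f → S v 0 = f 0 ∧ S v 1 = f 1

/-- A function whose weak derivative vanishes is constant. -/
theorem ae_const_of_weakDeriv_zero {g : ℝ → ℝ} (hg : IntegrableOn g (Ioo 0 1))
    (h : HasWeakDeriv 0 1 g (fun _ => 0)) :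
    ∃ c : ℝ, g =ᵐ[volume.restrict (Ioo 0 1)] fun _ => c := by
  let B : ContDiffBump (1 / 2 : ℝ) := ⟨1 / 8, 1 / 4, by norm_num, by norm_num⟩
  let ρ : ℝ → ℝ := B.normed volume
  have hρs : ContDiff ℝ ∞ ρ := B.contDiff_normed
  have hρc : HasCompactSupport ρ := B.hasCompactSupport_normed
  have hρt : tsupport ρ ⊆ Ioo 0 1 := by
    rw [B.tsupport_normed_eq, Real.closedBall_eq_Icc]
    intro x hx
    have : B.rOut = 1 / 4 := rfl
    rw [this] at hx
    constructor <;> linarith [hx.1, hx.2]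
  have hρ1 : ∫ x, ρ x = 1 := B.integral_normed
  have int_test : ∀ ψ : ℝ → ℝ, Continuous ψ → HasCompactSupport ψ →
      Integrable (fun x => ψ x * g x) (volume.restrict (Ioo 0 1)) := by
    intro ψ hψ hc
    obtain ⟨C, hC⟩ := hc.exists_bound_of_continuous hψ
    exact Integrable.bdd_mul hg hψ.aestronglyMeasurable (Eventually.of_forall hC)
  set c : ℝ := ∫ x in Ioo 0 1, ρ x * g x with hcdef
  refine ⟨c, ?_⟩
  have hci : IntegrableOn (fun x => g x - c) (Ioo 0 1) := Integrable.sub hg (integrable_const c)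
  have key := isOpen_Ioo.ae_eq_zero_of_integral_contDiff_smul_eq_zero
    (μ := volume.restrict (Ioo (0:ℝ) 1)) (U := Ioo 0 1) (f := fun x => g x - c)
    ((Integrable.locallyIntegrable hci).locallyIntegrableOn _) ?_
  · filter_upwards [key, ae_restrict_mem measurableSet_Ioo] with x hx hm
    linarith [hx hm]
  intro ψ hψs hψc hψt
  set m : ℝ := ∫ x, ψ x with hm
  set η : ℝ → ℝ := fun x => ψ x - m * ρ x with hη
  have hηs : ContDiff ℝ ∞ η := hψs.sub (contDiff_const.mul hρs)
  have hηc : Continuous η := hηs.continuous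
  obtain ⟨a', b', ha', hb', hK⟩ : ∃ a' b' : ℝ, 0 < a' ∧ b' < 1 ∧
      tsupport ψ ∪ tsupport ρ ⊆ Icc a' b' := by
    have hcomp : IsCompact (tsupport ψ ∪ tsupport ρ ∪ {1 / 2}) :=
      (hψc.isCompact.union hρc.isCompact).union isCompact_singleton
    have hne : (tsupport ψ ∪ tsupport ρ ∪ {(1 / 2 : ℝ)}).Nonempty := ⟨1 / 2, by simp⟩
    have hsub : tsupport ψ ∪ tsupport ρ ∪ {(1 / 2 : ℝ)} ⊆ Ioo 0 1 := by
      refine union_subset (union_subset hψt hρt) ?_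
      rintro x rfl
      constructor <;> norm_num
    obtain ⟨a', ha⟩ := hcomp.exists_isLeast hne
    obtain ⟨b', hb⟩ := hcomp.exists_isGreatest hne
    exact ⟨a', b', (hsub ha.1).1, (hsub hb.1).2, fun x hx => ⟨ha.2 (Or.inl hx), hb.2 (Or.inl hx)⟩⟩
  have hη0 : ∀ x, x ∉ Icc a' b' → η x = 0 := by
    intro x hx
    have h1 : ψ x = 0 := image_eq_zero_of_notMem_tsupport fun hh => hx (hK (Or.inl hh))
    have h2 : ρ x = 0 := image_eq_zero_of_notMem_tsupport fun hh => hx (hK (Or.inr hh))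
    simp [hη, h1, h2]
  have hηint : ∫ x in (0:ℝ)..1, η x = 0 := by
    have h1 : ∫ x in (0:ℝ)..1, η x = ∫ x, η x := by
      rw [intervalIntegral.integral_of_le zero_le_one]
      refine setIntegral_eq_integral_of_forall_compl_eq_zero fun x hx => hη0 x fun hh => hx ?_
      exact ⟨by linarith [hh.1], by linarith [hh.2]⟩
    rw [h1, hη, integral_sub (hψs.continuous.integrable_of_hasCompactSupport hψc)
      ((hρs.continuous.integrable_of_hasCompactSupport hρc).const_mul m),
      integral_const_mul, hρ1]
    simp [hm]
  set Φ : ℝ → ℝ := fun x => ∫ t in (0:ℝ)..x, η t with hΦ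
  have hΦd : ∀ x, HasDerivAt Φ (η x) x := fun x =>
    hηc.integral_hasStrictDerivAt 0 x |>.hasDerivAt
  have hΦ' : deriv Φ = η := funext fun x => (hΦd x).deriv
  have hΦ0 : ∀ x, x ∉ Icc a' b' → Φ x = 0 := by
    intro x hx
    by_cases hxa : x < a'
    · refine (intervalIntegral.integral_congr (g := fun _ => (0 : ℝ)) fun t ht => ?_).trans (by simp)
      refine hη0 t fun hh => ?_
      have : t ≤ max 0 x := ht.2
      have : max 0 x < a' := max_lt ha' hxa
      linarith [hh.1]
    · have hxb : b' < x := by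
        by_contra hh
        exact hx ⟨not_lt.1 hxa, not_lt.1 hh⟩
      have h2 : ∫ t in x..1, η t = 0 := by
        refine (intervalIntegral.integral_congr (g := fun _ => (0 : ℝ)) fun t ht => ?_).trans
          (by simp)
        refine hη0 t fun hh => ?_
        have : min x 1 ≤ t := ht.1
        have : b' < min x 1 := lt_min hxb hb'
        linarith [hh.2]
      have h3 := intervalIntegral.integral_add_adjacent_intervals
        (hηc.intervalIntegrable (μ := volume) 0 x) (hηc.intervalIntegrable x 1)
      rw [h2, hηint, add_zero] at h3
      exact h3
  have hΦsupp : tsupport Φ ⊆ Icc a' b' := by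
    refine closure_minimal ?_ isClosed_Icc
    intro x hx
    by_contra hh
    exact hx (hΦ0 x hh)
  have hΦtest : IsTest 0 1 Φ := by
    refine ⟨?_, ?_, ?_⟩
    · rw [contDiff_infty_iff_deriv, hΦ']
      exact ⟨fun x => (hΦd x).differentiableAt, hηs⟩
    · exact isCompact_Icc.of_isClosed_subset (isClosed_tsupport Φ) hΦsupp
    · intro x hx
      exact ⟨by linarith [(hΦsupp hx).1], by linarith [(hΦsupp hx).2]⟩
  have hz := h Φ hΦtest
  rw [hΦ'] at hz
  simp only [smul_eq_mul, mul_zero, integral_zero, neg_zero, hη, sub_mul, mul_assoc] at hz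
  rw [integral_sub (int_test ψ hψs.continuous hψc)
    ((int_test ρ hρs.continuous hρc).const_mul m), integral_const_mul] at hz
  have hmI : ∫ x in Ioo (0:ℝ) 1, ψ x = m :=
    setIntegral_eq_integral_of_forall_compl_eq_zero fun x hx =>
      image_eq_zero_of_notMem_tsupport fun hh => hx (hψt hh)
  simp only [smul_eq_mul, mul_sub]
  rw [integral_sub (int_test ψ hψs.continuous hψc)
    ((hψs.continuous.integrable_of_hasCompactSupport hψc).restrict.mul_const c),
    integral_mul_const, hmI]
  linarith

theorem weakDeriv_primitive {v : ℝ → ℝ} (hv : IntervalIntegrable v volume 0 1) :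
    HasWeakDeriv 0 1 (fun x => ∫ t in (0:ℝ)..x, v t) v := by
  intro φ hφ
  have h0 : φ 0 = 0 := image_eq_zero_of_notMem_tsupport fun hh => by simpa using (hφ.2.2 hh).1
  have h1 : φ 1 = 0 := image_eq_zero_of_notMem_tsupport fun hh => by simpa using (hφ.2.2 hh).2
  have hac := hv.absolutelyContinuousOnInterval_intervalIntegral (c := 0) (by simp)
  have hφac : AbsolutelyContinuousOnInterval φ 0 1 :=
    (hφ.1.of_le (by simp)).contDiffOn.absolutelyContinuousOnInterval
  have hp := hac.integral_mul_deriv_eq_deriv_mul hφac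
  rw [h0, h1, mul_zero, mul_zero, sub_zero, zero_sub] at hp
  simp only [smul_eq_mul]
  rw [← integral_Ioc_eq_integral_Ioo, ← integral_Ioc_eq_integral_Ioo,
    ← intervalIntegral.integral_of_le zero_le_one, ← intervalIntegral.integral_of_le zero_le_one]
  refine (intervalIntegral.integral_congr fun x _ => mul_comm _ _).trans (hp.trans ?_)
  congr 1
  refine intervalIntegral.integral_congr_ae ?_
  filter_upwards [hv.ae_hasDerivAt_integral] with x hx hm
  rw [(hx (uIoc_subset_uIcc hm) 0 (by simp)).deriv, mul_comm]

/-- Every element of `H¹(0,1)` is the primitive of its weak derivative, up to a constant. -/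
theorem Sob.exists_primitive (v : Sob 1) : ∃ c : ℝ,
    Sob.toL2 1 v =ᵐ[volume.restrict (Ioo 0 1)] fun x => c + ∫ t in (0:ℝ)..x, v.1 1 t := by
  have hi : ∀ f : L2 0 1 ℝ, IntegrableOn f (Ioo 0 1) := fun f =>
    (Lp.memLp f).integrable (by norm_num)
  have hii : ∀ f : L2 0 1 ℝ, IntervalIntegrable f volume 0 1 := fun f =>
    (intervalIntegrable_iff_integrableOn_Ioo_of_le zero_le_one).2 (hi f)
  set F : ℝ → ℝ := fun x => ∫ t in (0:ℝ)..x, v.1 1 t with hF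
  have hFc : ContinuousOn F (Icc 0 1) := by
    have := ((hii (v.1 1)).absolutelyContinuousOnInterval_intervalIntegral (c := 0)
      (by simp)).continuousOn
    rwa [uIcc_of_le zero_le_one] at this
  have hFi : IntegrableOn F (Ioo 0 1) :=
    (hFc.integrableOn_compact isCompact_Icc).mono_set Ioo_subset_Icc_self
  have hFw : HasWeakDeriv 0 1 F (v.1 1) := weakDeriv_primitive (hii _)
  have hvw : HasWeakDeriv 0 1 (v.1 0) (v.1 1) := v.2 0
  obtain ⟨c, hc⟩ := ae_const_of_weakDeriv_zero (g := fun x => v.1 0 x - F x)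
    (Integrable.sub (hi _) hFi) (by
      intro φ hφ
      have hFφ : Integrable (fun x => deriv φ x • F x) (volume.restrict (Ioo 0 1)) := by
        obtain ⟨C, hC⟩ := hφ.2.1.deriv.exists_bound_of_continuous hφ.deriv_continuous
        exact Integrable.bdd_mul (c := C) hFi hφ.deriv_continuous.aestronglyMeasurable
          (Eventually.of_forall hC)
      simp only [smul_sub]
      rw [integral_sub (integrable_smul_L2 hφ.deriv_continuous hφ.2.1.deriv _) hFφ,
        hvw φ hφ, hFw φ hφ]
      simp)
  refine ⟨c, ?_⟩
  filter_upwards [hc] with x hx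
  change v.1 0 x = c + F x
  linarith

theorem exists_isTrace : ∃ S, IsTrace S := by
  have hq : ∀ i : Fin 2, MemLp (fun x : ℝ => x - 1 + (i : ℝ)) 2 (volume.restrict (Ioo 0 1)) := by
    intro i
    refine MemLp.of_bound (by fun_prop) 2 ?_
    filter_upwards [ae_restrict_mem measurableSet_Ioo] with x hx
    rw [Real.norm_eq_abs, abs_le]
    fin_cases i <;> simp <;> constructor <;> linarith [hx.1, hx.2]
  let one : L2 0 1 ℝ := (memLp_const (1 : ℝ)).toLp
  let q : Fin 2 → L2 0 1 ℝ := fun i => (hq i).toLp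
  let pr : Fin 2 → Sob 1 →L[ℝ] L2 0 1 ℝ := fun i =>
    (PiLp.proj 2 (𝕜 := ℝ) (fun _ : Fin (1 + 1) => L2 0 1 ℝ) i) ∘L (Sob 1).subtypeL
  let l : Fin 2 → Sob 1 →L[ℝ] ℝ := fun i => innerSL ℝ one ∘L pr 0 + innerSL ℝ (q i) ∘L pr 1
  let S : Sob 1 →L[ℝ] EuclideanSpace ℝ (Fin 2) :=
    ((EuclideanSpace.equiv (Fin 2) ℝ).symm : (Fin 2 → ℝ) →L[ℝ] EuclideanSpace ℝ (Fin 2)) ∘L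
      ContinuousLinearMap.pi l
  refine ⟨S, fun v f hf hvf => ?_⟩
  obtain ⟨c, hc⟩ := Sob.exists_primitive v
  have hi : IntervalIntegrable (v.1 1) volume 0 1 :=
    (intervalIntegrable_iff_integrableOn_Ioo_of_le zero_le_one).2
      ((Lp.memLp (v.1 1)).integrable (by norm_num))
  set F : ℝ → ℝ := fun x => ∫ t in (0:ℝ)..x, v.1 1 t with hF
  have hac : AbsolutelyContinuousOnInterval F 0 1 :=
    hi.absolutelyContinuousOnInterval_intervalIntegral (c := 0) (by simp)
  have hFc : ContinuousOn F (Icc 0 1) := by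
    have := hac.continuousOn
    rwa [uIcc_of_le zero_le_one] at this
  have hFii : IntervalIntegrable F volume 0 1 :=
    ContinuousOn.intervalIntegrable_of_Icc zero_le_one hFc
  have heq : EqOn f (fun x => c + F x) (Icc 0 1) := by
    refine Measure.eqOn_Icc_of_ae_eq volume zero_ne_one ?_ hf (continuousOn_const.add hFc)
    rw [← restrict_Ioo_eq_restrict_Icc]
    exact hvf.symm.trans hc
  have hS : ∀ i, S v i = c + F 1 * (i : ℝ) := by
    intro i
    have e1 : inner ℝ one (pr 0 v) = c + ∫ x in (0:ℝ)..1, F x := by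
      rw [MeasureTheory.L2.inner_def]
      have : ∫ x in Ioo (0:ℝ) 1, inner ℝ (one x) (pr 0 v x) = ∫ x in Ioo (0:ℝ) 1, (c + F x) := by
        refine integral_congr_ae ?_
        filter_upwards [hc, (memLp_const (1 : ℝ)).coeFn_toLp (p := 2)
          (μ := volume.restrict (Ioo (0:ℝ) 1))] with x hx h1
        have h2 : one x = 1 := h1
        have h3 : pr 0 v x = c + F x := hx
        rw [h2, h3]
        simp
      rw [this, ← integral_Ioc_eq_integral_Ioo, ← intervalIntegral.integral_of_le zero_le_one,
        intervalIntegral.integral_add (by simp) hFii]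
      simp
    have e2 : inner ℝ (q i) (pr 1 v) = ∫ x in (0:ℝ)..1, v.1 1 x * (x - 1 + (i : ℝ)) := by
      rw [MeasureTheory.L2.inner_def, intervalIntegral.integral_of_le zero_le_one,
        integral_Ioc_eq_integral_Ioo]
      refine integral_congr_ae ?_
      filter_upwards [(hq i).coeFn_toLp] with x h1
      have h2 : q i x = x - 1 + (i : ℝ) := h1
      rw [h2]
      rfl
    have hlin : AbsolutelyContinuousOnInterval (fun x : ℝ => x - 1 + (i : ℝ)) 0 1 := by
      have : ContDiff ℝ 1 (fun x : ℝ => x - 1 + (i : ℝ)) := by fun_prop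
      exact this.contDiffOn.absolutelyContinuousOnInterval
    have hp := hac.integral_mul_deriv_eq_deriv_mul hlin
    have e3 : ∫ x in (0:ℝ)..1, deriv F x * (x - 1 + (i : ℝ))
        = ∫ x in (0:ℝ)..1, v.1 1 x * (x - 1 + (i : ℝ)) := by
      refine intervalIntegral.integral_congr_ae ?_
      filter_upwards [hi.ae_hasDerivAt_integral] with x hx hm
      rw [(hx (uIoc_subset_uIcc hm) 0 (by simp)).deriv]
    have hF0 : F 0 = 0 := by simp [hF]
    have hd : ∀ x : ℝ, deriv (fun x : ℝ => x - 1 + (i : ℝ)) x = 1 := fun x => by simp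
    simp only [hd, mul_one] at hp
    rw [e3, hF0] at hp
    change inner ℝ one (pr 0 v) + inner ℝ (q i) (pr 1 v) = _
    rw [e1, e2, hp]
    ring
  have hF0 : F 0 = 0 := by simp [hF]
  rw [hS, hS, heq (by simp), heq (by simp)]
  simp [hF0]

theorem IsTrace.unique {S S' : Sob 1 →L[ℝ] EuclideanSpace ℝ (Fin 2)} (hS : IsTrace S)
    (hS' : IsTrace S') : S = S' := by
  ext v i
  obtain ⟨c, hc⟩ := Sob.exists_primitive v
  have hi : IntervalIntegrable (v.1 1) volume 0 1 :=
    (intervalIntegrable_iff_integrableOn_Ioo_of_le zero_le_one).2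
      ((Lp.memLp (v.1 1)).integrable (by norm_num))
  have hFc := (hi.absolutelyContinuousOnInterval_intervalIntegral (c := 0) (by simp)).continuousOn
  rw [uIcc_of_le zero_le_one] at hFc
  have h1 := hS v _ (continuousOn_const.add hFc) hc
  have h2 := hS' v _ (continuousOn_const.add hFc) hc
  fin_cases i
  · exact h1.1.trans h2.1.symm
  · exact h1.2.trans h2.2.symm

/-- The trace operator `H¹(0,1) → L²(∂(0,1))`: the unique map with the property `IsTrace`. The
component `0` of the target is the value at the endpoint `0`, the component `1` the value
at the endpoint `1`. -/
noncomputable def trace : Sob 1 →L[ℝ] EuclideanSpace ℝ (Fin 2) := exists_isTrace.choose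

theorem isTrace_trace : IsTrace trace := exists_isTrace.choose_spec

/-- For `u ∈ L²(0,T; H²(0,1))`, the lateral boundary function `t ↦ trace (u t) (i) ∈ L²(0,T)`,
where `i = 0, 1` is one of the two endpoints of `(0,1)`. -/
noncomputable def lateralTrace {T : ℝ} (i : Fin 2) (u : L2 0 T (Sob 2)) : L2 0 T ℝ :=
  ((EuclideanSpace.proj i : EuclideanSpace ℝ (Fin 2) →L[ℝ] ℝ) ∘L trace ∘L Sob.incl 1).compLp u

/-- `u' ∈ L²(0,T; L²(0,1))` is the weak time derivative of `u ∈ L²(0,T; H²(0,1))`. -/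
def HasWeakTimeDeriv {T : ℝ} (u : L2 0 T (Sob 2)) (u' : L2 0 T (L2 0 1 ℝ)) : Prop :=
  HasWeakDeriv 0 T (fun t => Sob.toL2 2 (u t)) u'

/-- `g = u(0)`: the function `u`, after modification on a null set of times, is continuous from
`[0,T]` to `L²(0,1)`, with value `g` at time `0`. -/
def IsInitialValue {T : ℝ} (u : L2 0 T (Sob 2)) (g : L2 0 1 ℝ) : Prop :=
  ∃ w : ℝ → L2 0 1 ℝ, ContinuousOn w (Icc 0 T) ∧
    (fun t => Sob.toL2 2 (u t)) =ᵐ[volume.restrict (Ioo 0 T)] w ∧ w 0 = g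

end TraceEstimate

namespace TraceEstimate

/-! ### Weak derivatives of Banach-valued functions, tested by duality. -/

section vector

variable {E : Type*} [NormedAddCommGroup E] [NormedSpace ℝ E]

/-! The lateral bounds need no time derivative: restricting to `H¹`, taking the trace and reading
one component is a bounded functional on `H²`, and composing it with `u` pointwise in time costs
only its operator norm.

The initial value comes from the fundamental theorem of calculus in `L²(0,1)`. The function `t ↦ u t
- ∫₀ᵗ u'` has zero weak derivative, hence is a.e. a constant `g`, and `g + ∫₀ᵗ u'` is the continuous
representative (`HasWeakDeriv.exists_eq_add_primitive`). The Banach-valued statements reduce to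
scalar ones by applying continuous functionals, and constancy on `(0,T)` reduces to `(0,1)` by
rescaling.

Finally `‖g‖ ≤ ‖u t‖_{L²} + ∫₀ᵀ ‖u'‖` for a.e. `t`; integrating in `t` and applying Cauchy–Schwarz
bounds `‖g‖` (`norm_initialValue_le`). -/

theorem _root_.MeasureTheory.IntegrableOn.smul_compactSupport {a b : ℝ} {φ : ℝ → ℝ} {f : ℝ → E}
    (hf : IntegrableOn f (Ioo a b)) (hφ : Continuous φ) (hc : HasCompactSupport φ) :
    IntegrableOn (fun x => φ x • f x) (Ioo a b) := by
  obtain ⟨C, hC⟩ := hc.exists_bound_of_continuous hφ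
  exact Integrable.bdd_smul hf C hφ.aestronglyMeasurable (Eventually.of_forall hC)

/-- For integrable functions, the weak derivative can be tested with continuous functionals. -/
theorem hasWeakDeriv_iff_dual [CompleteSpace E] {a b : ℝ} {f f' : ℝ → E}
    (hf : IntegrableOn f (Ioo a b)) (hf' : IntegrableOn f' (Ioo a b)) :
    HasWeakDeriv a b f f' ↔
      ∀ L : E →L[ℝ] ℝ, HasWeakDeriv a b (fun x => L (f x)) (fun x => L (f' x)) := by
  have key : ∀ (L : E →L[ℝ] ℝ) (φ : ℝ → ℝ), Continuous φ → HasCompactSupport φ →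
      ∀ h : ℝ → E, IntegrableOn h (Ioo a b) →
      ∫ x in Ioo a b, φ x • L (h x) = L (∫ x in Ioo a b, φ x • h x) := by
    intro L φ hφ hc h hh
    rw [← L.integral_comp_comm (hh.smul_compactSupport hφ hc)]
    simp
  constructor
  · intro h L φ hφ
    rw [key L _ hφ.deriv_continuous hφ.2.1.deriv f hf, key L _ hφ.1.continuous hφ.2.1 f' hf',
      h φ hφ, map_neg]
  · intro h φ hφ
    -- By Hahn–Banach, functionals separate the two vector integrals.
    rw [SeparatingDual.eq_iff_forall_dual_eq (R := ℝ)]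
    intro L
    rw [map_neg, ← key L _ hφ.deriv_continuous hφ.2.1.deriv f hf,
      ← key L _ hφ.1.continuous hφ.2.1 f' hf', h L φ hφ]

theorem HasWeakDeriv.sub {a b : ℝ} {f f' g g' : ℝ → E}
    (hf : IntegrableOn f (Ioo a b)) (hf' : IntegrableOn f' (Ioo a b))
    (hg : IntegrableOn g (Ioo a b)) (hg' : IntegrableOn g' (Ioo a b))
    (h : HasWeakDeriv a b f f') (k : HasWeakDeriv a b g g') :
    HasWeakDeriv a b (fun x => f x - g x) (fun x => f' x - g' x) := by
  intro φ hφ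
  simp only [smul_sub]
  rw [integral_sub (hf.smul_compactSupport hφ.deriv_continuous hφ.2.1.deriv)
      (hg.smul_compactSupport hφ.deriv_continuous hφ.2.1.deriv),
    integral_sub (hf'.smul_compactSupport hφ.1.continuous hφ.2.1)
      (hg'.smul_compactSupport hφ.1.continuous hφ.2.1), h φ hφ, k φ hφ]
  abel

end vector

/-! ### Scalar functions on `(0,T)`. -/

theorem setIntegral_Ioo_comp_mul_left {T : ℝ} (hT : 0 < T) (g : ℝ → ℝ) :
    ∫ x in Ioo 0 1, g (T * x) = T⁻¹ * ∫ t in Ioo 0 T, g t := by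
  rw [← integral_Ioc_eq_integral_Ioo, ← integral_Ioc_eq_integral_Ioo,
    ← intervalIntegral.integral_of_le zero_le_one, ← intervalIntegral.integral_of_le hT.le,
    intervalIntegral.integral_comp_mul_left _ hT.ne']
  simp

theorem IsTest.comp_inv_mul {T : ℝ} (hT : 0 < T) {φ : ℝ → ℝ} (hφ : IsTest 0 1 φ) :
    IsTest 0 T (fun t => φ (T⁻¹ * t)) := by
  have hs : tsupport (fun t => φ (T⁻¹ * t)) ⊆ (fun t => T⁻¹ * t) ⁻¹' tsupport φ :=
    tsupport_comp_subset_preimage φ (by fun_prop)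
  refine ⟨hφ.1.comp (by fun_prop), ?_, fun t ht => ?_⟩
  · exact hφ.2.1.comp_homeomorph (Homeomorph.mulLeft₀ T⁻¹ (inv_ne_zero hT.ne'))
  · have h := hφ.2.2 (hs ht)
    simp only [← div_eq_inv_mul] at h
    exact ⟨by simpa [hT] using (div_pos_iff_of_pos_right hT).1 h.1, (div_lt_one hT).1 h.2⟩

theorem ae_const_of_weakDeriv_zero_Ioo {T : ℝ} (hT : 0 < T) {g : ℝ → ℝ}
    (hg : IntegrableOn g (Ioo 0 T)) (h : HasWeakDeriv 0 T g (fun _ => 0)) :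
    ∃ c : ℝ, g =ᵐ[volume.restrict (Ioo 0 T)] fun _ => c := by
  obtain ⟨c, hc⟩ := ae_const_of_weakDeriv_zero (g := fun x => g (T * x)) (by
      rw [← intervalIntegrable_iff_integrableOn_Ioo_of_le hT.le] at hg
      rw [← intervalIntegrable_iff_integrableOn_Ioo_of_le zero_le_one]
      simpa [hT.ne'] using hg.comp_mul_left (c := T)) (by
    intro φ hφ
    have h1 := h _ (hφ.comp_inv_mul hT)
    -- The chain rule puts a factor `T⁻¹` in front of the integral over `(0,1)`; it is nonzero, so
    -- that integral vanishes.
    have h2 := setIntegral_Ioo_comp_mul_left hT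
      (fun t => deriv (fun s => φ (T⁻¹ * s)) t • g t)
    rw [h1] at h2
    simp only [deriv_comp_mul_left, inv_mul_cancel_left₀ hT.ne', smul_eq_mul, mul_zero,
      integral_zero, neg_zero, mul_assoc, integral_const_mul] at h2 ⊢
    simpa [hT.ne'] using h2)
  refine ⟨c, ?_⟩
  rw [EventuallyEq, ae_restrict_iff' measurableSet_Ioo] at hc ⊢
  -- Pulling back along `t ↦ T⁻¹ * t` preserves null sets, which carries the a.e. identity from
  -- `(0,1)` to `(0,T)`.
  have hq : Measure.QuasiMeasurePreserving (fun t : ℝ => T⁻¹ * t) := by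
    refine ⟨by fun_prop, ?_⟩
    rw [Real.map_volume_mul_left (inv_ne_zero hT.ne')]
    exact Measure.smul_absolutelyContinuous
  filter_upwards [hq.ae hc] with t ht hm
  have := ht ⟨by have := hm.1; positivity, by
    rw [← div_eq_inv_mul]; exact (div_lt_one hT).2 hm.2⟩
  rwa [mul_inv_cancel_left₀ hT.ne'] at this

/-- Integration by parts for absolutely continuous functions; the boundary terms drop because a test
function vanishes at both endpoints. -/
theorem weakDeriv_primitive_Ioo {T : ℝ} (hT : 0 < T) {v : ℝ → ℝ}
    (hv : IntervalIntegrable v volume 0 T) :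
    HasWeakDeriv 0 T (fun x => ∫ t in (0:ℝ)..x, v t) v := by
  intro φ hφ
  have h0 : φ 0 = 0 := image_eq_zero_of_notMem_tsupport fun hh => by simpa using (hφ.2.2 hh).1
  have h1 : φ T = 0 := image_eq_zero_of_notMem_tsupport fun hh => by simpa using (hφ.2.2 hh).2
  have hac := hv.absolutelyContinuousOnInterval_intervalIntegral (c := 0) (by simp)
  have hφac : AbsolutelyContinuousOnInterval φ 0 T :=
    (hφ.1.of_le (by simp)).contDiffOn.absolutelyContinuousOnInterval
  have hp := hac.integral_mul_deriv_eq_deriv_mul hφac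
  rw [h0, h1, mul_zero, mul_zero, sub_zero, zero_sub] at hp
  simp only [smul_eq_mul]
  rw [← integral_Ioc_eq_integral_Ioo, ← integral_Ioc_eq_integral_Ioo,
    ← intervalIntegral.integral_of_le hT.le, ← intervalIntegral.integral_of_le hT.le]
  refine (intervalIntegral.integral_congr fun x _ => mul_comm _ _).trans (hp.trans ?_)
  congr 1
  refine intervalIntegral.integral_congr_ae ?_
  filter_upwards [hv.ae_hasDerivAt_integral] with x hx hm
  rw [(hx (uIoc_subset_uIcc hm) 0 (by simp)).deriv, mul_comm]

/-! ### Banach-valued functions with an integrable weak derivative. -/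

section vector

variable {E : Type*} [NormedAddCommGroup E] [NormedSpace ℝ E] [CompleteSpace E]

/-- A Banach-space valued function whose weak derivative vanishes is constant. -/
theorem HasWeakDeriv.ae_const {T : ℝ} (hT : 0 < T) {f : ℝ → E}
    (hf : IntegrableOn f (Ioo 0 T)) (h : HasWeakDeriv 0 T f (fun _ => 0)) :
    ∃ c : E, f =ᵐ[volume.restrict (Ioo 0 T)] fun _ => c := by
  have hL := (hasWeakDeriv_iff_dual hf (integrable_zero _ _ _)).1 h
  -- The constant must be a vector chosen before any functional; a constant function equals its
  -- mean.
  set c : E := T⁻¹ • ∫ t in Ioo 0 T, f t with hc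
  refine ⟨c, ?_⟩
  have hdual : ∀ L : E →L[ℝ] ℝ,
      (fun t => L (f t)) =ᵐ[volume.restrict (Ioo 0 T)] fun _ => L c := by
    intro L
    obtain ⟨d, hd⟩ := ae_const_of_weakDeriv_zero_Ioo hT (L.integrable_comp hf)
      (by simpa using hL L)
    have : L c = d := by
      rw [hc, map_smul, ← L.integral_comp_comm hf, integral_congr_ae hd]
      simp [hT.le, hT.ne']
    rwa [this]
  have hci : IntegrableOn (fun x => f x - c) (Ioo 0 T) := Integrable.sub hf (integrable_const c)
  have key := isOpen_Ioo.ae_eq_zero_of_integral_contDiff_smul_eq_zero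
    (μ := volume.restrict (Ioo (0:ℝ) T)) (U := Ioo 0 T) (f := fun x => f x - c)
    ((Integrable.locallyIntegrable hci).locallyIntegrableOn _) ?_
  · filter_upwards [key, ae_restrict_mem measurableSet_Ioo] with x hx hm
    exact sub_eq_zero.1 (hx hm)
  -- The null set in `hdual` depends on `L`, so functionals cannot be separated pointwise in time.
  -- They are applied to the integral against `ψ` instead.
  intro ψ hψs hψc _
  rw [SeparatingDual.eq_zero_iff_forall_dual_eq_zero (R := ℝ)]
  intro L
  rw [← L.integral_comp_comm (hci.smul_compactSupport hψs.continuous hψc)]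
  refine integral_eq_zero_of_ae ?_
  filter_upwards [hdual L] with x hx
  simp [hx]

/-- Continuous functionals commute with the Bochner integral, so the scalar case applies to each of
them. -/
theorem hasWeakDeriv_primitive {T : ℝ} (hT : 0 < T) {v : ℝ → E}
    (hv : IntegrableOn v (Ioo 0 T)) :
    HasWeakDeriv 0 T (fun x => ∫ t in (0:ℝ)..x, v t) v := by
  have hi : IntervalIntegrable v volume 0 T :=
    (intervalIntegrable_iff_integrableOn_Ioo_of_le hT.le).2 hv
  have hF : IntegrableOn (fun x => ∫ t in (0:ℝ)..x, v t) (Ioo 0 T) := by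
    have := intervalIntegral.continuousOn_primitive_interval' hi (a := 0) (by simp)
    rw [uIcc_of_le hT.le] at this
    exact (this.integrableOn_compact isCompact_Icc).mono_set Ioo_subset_Icc_self
  rw [hasWeakDeriv_iff_dual hF hv]
  intro L
  have h := weakDeriv_primitive_Ioo hT (v := fun t => L (v t))
    ((intervalIntegrable_iff_integrableOn_Ioo_of_le hT.le).2 (L.integrable_comp hv))
  refine h.congr ?_ EventuallyEq.rfl
  filter_upwards [ae_restrict_mem measurableSet_Ioo] with x hx
  refine L.intervalIntegral_comp_comm (hi.mono_set ?_)
  rw [uIcc_of_le hx.1.le, uIcc_of_le hT.le]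
  exact Icc_subset_Icc_right hx.2.le

/-- A function with an integrable weak derivative is, almost everywhere, a primitive of it. -/
theorem HasWeakDeriv.exists_eq_add_primitive {T : ℝ} (hT : 0 < T) {f v : ℝ → E}
    (hf : IntegrableOn f (Ioo 0 T)) (hv : IntegrableOn v (Ioo 0 T))
    (h : HasWeakDeriv 0 T f v) :
    ContinuousOn (fun x => ∫ t in (0:ℝ)..x, v t) (Icc 0 T) ∧
      ∃ c : E, f =ᵐ[volume.restrict (Ioo 0 T)] fun x => c + ∫ t in (0:ℝ)..x, v t := by
  have hF : ContinuousOn (fun x => ∫ t in (0:ℝ)..x, v t) (Icc 0 T) := by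
    rw [← uIcc_of_le hT.le]
    exact intervalIntegral.continuousOn_primitive_interval'
      ((intervalIntegrable_iff_integrableOn_Ioo_of_le hT.le).2 hv) (by simp)
  have hFi : IntegrableOn (fun x => ∫ t in (0:ℝ)..x, v t) (Ioo 0 T) :=
    (hF.integrableOn_compact isCompact_Icc).mono_set Ioo_subset_Icc_self
  obtain ⟨c, hc⟩ := HasWeakDeriv.ae_const hT (f := fun x => f x - ∫ t in (0:ℝ)..x, v t)
    (Integrable.sub hf hFi) (by simpa using h.sub hf hv hFi hv (hasWeakDeriv_primitive hT hv))
  refine ⟨hF, c, ?_⟩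
  filter_upwards [hc] with x hx
  rw [← hx]
  simp

end vector

/-! ### Initial values and their norm estimate. -/

/-- Cauchy–Schwarz against the constant `1`, whose `L²(0,T)` norm is `√T`. -/
theorem integral_norm_le_sqrt_mul {E : Type*} [NormedAddCommGroup E] {T : ℝ} (hT : 0 < T)
    (f : L2 0 T E) : ∫ t in Ioo 0 T, ‖f t‖ ≤ Real.sqrt T * ‖f‖ := by
  have h := eLpNorm_le_eLpNorm_mul_rpow_measure_univ (p := 1) (q := 2) (by norm_num)
    (Lp.aestronglyMeasurable f)
  rw [integral_norm_eq_lintegral_enorm (Lp.aestronglyMeasurable f),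
    ← eLpNorm_one_eq_lintegral_enorm, Lp.norm_def, mul_comm]
  refine (ENNReal.toReal_mono (ENNReal.mul_ne_top (Lp.eLpNorm_ne_top f)
    (ENNReal.rpow_ne_top_of_nonneg (by norm_num) (by simp))) h).trans_eq ?_
  rw [ENNReal.toReal_mul, ← ENNReal.toReal_rpow, Measure.restrict_apply_univ, Real.volume_Ioo,
    sub_zero, ENNReal.toReal_ofReal hT.le, Real.sqrt_eq_rpow]
  norm_num

theorem L2.integrableOn {E : Type*} [NormedAddCommGroup E] {a b : ℝ} (f : L2 a b E) :
    IntegrableOn f (Ioo a b) := (Lp.memLp f).integrable (by norm_num)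

section evolution

variable {T : ℝ} {u : L2 0 T (Sob 2)} {u' : L2 0 T (L2 0 1 ℝ)}

theorem integrableOn_toL2 (u : L2 0 T (Sob 2)) :
    IntegrableOn (fun t => Sob.toL2 2 (u t)) (Ioo 0 T) :=
  (Sob.toL2 2).integrable_comp u.integrableOn

/-- Continuous functions that agree a.e. on a nondegenerate interval agree everywhere on its
closure, in particular at `0`. -/
theorem IsInitialValue.unique (hT : 0 < T) {g g' : L2 0 1 ℝ} (h : IsInitialValue u g)
    (h' : IsInitialValue u g') : g = g' := by
  obtain ⟨w, hw, hae, rfl⟩ := h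
  obtain ⟨w', hw', hae', rfl⟩ := h'
  refine Measure.eqOn_Icc_of_ae_eq volume hT.ne ?_ hw hw' ⟨le_rfl, hT.le⟩
  rw [← restrict_Ioo_eq_restrict_Icc]
  exact hae.symm.trans hae'

/-- The primitive starts at `0`, so the constant of integration is the initial value. The explicit
formula is kept for the norm estimate. -/
theorem HasWeakTimeDeriv.exists_isInitialValue (hT : 0 < T) (h : HasWeakTimeDeriv u u') :
    ∃ g : L2 0 1 ℝ, IsInitialValue u g ∧ (fun t => Sob.toL2 2 (u t))
      =ᵐ[volume.restrict (Ioo 0 T)] fun t => g + ∫ s in (0:ℝ)..t, u' s := by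
  obtain ⟨hF, c, hc⟩ := HasWeakDeriv.exists_eq_add_primitive hT (integrableOn_toL2 u)
    u'.integrableOn h
  exact ⟨c, ⟨_, continuousOn_const.add hF, hc, by simp⟩, hc⟩

/-- Since `g` does not depend on `t`, the pointwise triangle inequality can be integrated over
`(0,T)`, which produces the factor `T` on the left. -/
theorem norm_initialValue_le (hT : 0 < T) {g : L2 0 1 ℝ}
    (h : (fun t => Sob.toL2 2 (u t)) =ᵐ[volume.restrict (Ioo 0 T)]
      fun t => g + ∫ s in (0:ℝ)..t, u' s) :
    T * ‖g‖ ≤ Real.sqrt T * (‖Sob.toL2 2‖ * ‖u‖) + T * (Real.sqrt T * ‖u'‖) := by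
  have hpt : ∀ᵐ t ∂volume.restrict (Ioo 0 T),
      ‖g‖ ≤ ‖Sob.toL2 2‖ * ‖u t‖ + Real.sqrt T * ‖u'‖ := by
    filter_upwards [h, ae_restrict_mem measurableSet_Ioo] with t ht hm
    have hF : ‖∫ s in (0:ℝ)..t, u' s‖ ≤ Real.sqrt T * ‖u'‖ := by
      refine le_trans ?_ (integral_norm_le_sqrt_mul hT u')
      rw [intervalIntegral.integral_of_le hm.1.le]
      refine (norm_integral_le_integral_norm _).trans (setIntegral_mono_set
        u'.integrableOn.norm (Eventually.of_forall fun _ => norm_nonneg _) ?_)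
      exact (Ioc_subset_Ioo_right hm.2).eventuallyLE
    calc ‖g‖ = ‖Sob.toL2 2 (u t) - ∫ s in (0:ℝ)..t, u' s‖ := by rw [ht]; simp
      _ ≤ ‖Sob.toL2 2 (u t)‖ + ‖∫ s in (0:ℝ)..t, u' s‖ := norm_sub_le _ _
      _ ≤ _ := add_le_add ((Sob.toL2 2).le_opNorm _) hF
  have hint : IntegrableOn (fun t => ‖Sob.toL2 2‖ * ‖u t‖) (Ioo 0 T) :=
    u.integrableOn.norm.const_mul _
  have hmono := integral_mono_ae (integrable_const _) (hint.add (integrable_const _)) hpt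
  simp only [Pi.add_apply] at hmono
  rw [integral_add hint (integrable_const _), integral_const_mul] at hmono
  simp only [integral_const, measureReal_restrict_apply_univ, Real.volume_real_Ioo_of_le hT.le,
    sub_zero, smul_eq_mul] at hmono
  have hu := mul_le_mul_of_nonneg_left (integral_norm_le_sqrt_mul hT u) (norm_nonneg (Sob.toL2 2))
  linarith

end evolution

end TraceEstimate

theorem mainTheorem8 (T : ℝ) (hT : 0 < T) :
    ∃ C : ℝ, 0 < C ∧
      ∀ (u : TraceEstimate.L2 0 T (TraceEstimate.Sob 2))
        (u' : TraceEstimate.L2 0 T (TraceEstimate.L2 0 1 ℝ)),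
        TraceEstimate.HasWeakTimeDeriv u u' →
          (∃! g : TraceEstimate.L2 0 1 ℝ, TraceEstimate.IsInitialValue u g) ∧
          ∀ g : TraceEstimate.L2 0 1 ℝ, TraceEstimate.IsInitialValue u g →
            ‖TraceEstimate.lateralTrace 0 u‖ + ‖TraceEstimate.lateralTrace 1 u‖ + ‖g‖
              ≤ C * (‖u‖ + ‖u'‖) := by
  let tr (i : Fin 2) : TraceEstimate.Sob 2 →L[ℝ] ℝ :=
    (EuclideanSpace.proj i : EuclideanSpace ℝ (Fin 2) →L[ℝ] ℝ) ∘L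
      TraceEstimate.trace ∘L TraceEstimate.Sob.incl 1
  -- The coefficient of `‖u‖` in `norm_initialValue_le` after division by `T`.
  set M : ℝ := T⁻¹ * (Real.sqrt T * ‖TraceEstimate.Sob.toL2 2‖) with hM
  have hM0 : 0 ≤ M := by positivity
  refine ⟨‖tr 0‖ + ‖tr 1‖ + M + Real.sqrt T, by positivity, fun u u' h => ?_⟩
  obtain ⟨g, hg, hae⟩ := h.exists_isInitialValue hT
  refine ⟨⟨g, hg, fun g' hg' => hg'.unique hT hg⟩, fun g' hg' => ?_⟩
  obtain rfl := hg'.unique hT hg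
  have hb : ‖g'‖ ≤ M * ‖u‖ + Real.sqrt T * ‖u'‖ := by
    refine le_of_mul_le_mul_left ((TraceEstimate.norm_initialValue_le hT hae).trans_eq ?_) hT
    rw [hM]
    field_simp
  have h0 : ‖TraceEstimate.lateralTrace 0 u‖ ≤ ‖tr 0‖ * ‖u‖ :=
    ContinuousLinearMap.norm_compLp_le _ _
  have h1 : ‖TraceEstimate.lateralTrace 1 u‖ ≤ ‖tr 1‖ * ‖u‖ :=
    ContinuousLinearMap.norm_compLp_le _ _
  -- These are exactly the terms of `C * (‖u‖ + ‖u'‖)` that the three bounds leave unused.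
  have hc : 0 ≤ Real.sqrt T * ‖u‖ + (‖tr 0‖ + ‖tr 1‖ + M) * ‖u'‖ := by positivity
  linarith
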